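/- **Setting.** For $\beta>0$, a probability measure $\pi$ on $\mathbb R$ is *$\beta$-log-smooth* if it has a density proportional to $e^{-V}$, where $V:\mathbb R\to\mathbb R$ (a *potential* of $\pi$, determined up to an additive constant) is twice continuously differentiable with $|V'(x)-V'(y)|\le\beta|x-y|$ for all $x,y\in\mathbb R$. For a probability measure $\mu$ on $\mathbb R$, let $$\mathrm{FI}(\mu\|\pi)=\mathbb E_\mu\Big[\Big|\Big(\ln\frac{d\mu}{d\pi}\Big)'\Big|^2\Big],$$ with $\mathrm{FI}(\mu\|\pi)=\infty$ unless $\mu\ll\pi$ and $d\mu/d\pi$ has a locally absolutely continuous version. An *algorithm with $n$ queries* has a random seed and, at no cost, an unlimited supply of independent samples from an initial distribution $\mu_0$, independent of the seed. It adaptively chooses query points $x_1,\dots,x_n\in\mathbb R$, each a measurable function of the seed, the samples, and the previous points and answers. The answer to the query $x_i$ is $(V(x_i),V'(x_i))$, where $V$ is a fixed but unknown potential of the target (so that the values of the potential are known only up to an additive constant). The output is a real number that is a measurable function of the seed, the samples, and all points and answers; let $\mu$ be its law. The *query complexity* $\mathscr C(d=1,K_0,\varepsilon;\beta)\in\mathbb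 N\cup\{\infty\}$ is the least $n$ for which some algorithm with $n$ queries achieves $\sqrt{\mathrm{FI}(\mu\|\pi)}\le\varepsilon$ for every $\beta$-log-smooth target $\pi$ on $\mathbb R$, every potential $V$ of $\pi$, and every initial distribution $\mu_0$ with $\mathrm{KL}(\mu_0\|\pi)\le K_0$. Write $\mathscr C(1,K_0,\varepsilon)=\mathscr C(d=1,K_0,\varepsilon;\beta=1)$. **Theorem.** There exist universal constants $c\in(0,1)$ and $C>0$ such that for all $0<\varepsilon<c$, $$\mathscr C(d=1,K_0=1,\varepsilon)\;\ge\;\frac{C}{\varepsilon\sqrt{\log(1/\varepsilon)}}.$$ -/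

import Mathlib

open MeasureTheory ProbabilityTheory

noncomputable section

namespace FisherSampling

/-- `V` is a potential of a `β`-log-smooth distribution on `ℝ`: it is twice continuously
differentiable, `V'` is `β`-Lipschitz, and `exp (-V)` can be normalized to a probability density. -/
structure IsLogSmoothPotential (β : ℝ) (V : ℝ → ℝ) : Prop where
  contDiff : ContDiff ℝ 2 V
  deriv_lipschitz : ∀ x y : ℝ, |deriv V x - deriv V y| ≤ β * |x - y|
  integrable : Integrable (fun x => Real.exp (-V x)) volume

/-- The distribution `π ∝ exp (-V)`, with density `exp (-V) / ∫ exp (-V)` with respect to Lebesgue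
measure. -/
def gibbs (V : ℝ → ℝ) : Measure ℝ :=
  volume.tilted (fun x => -V x)

/-- The relative Fisher information `FI(μ ‖ π) = 𝔼_μ [|(ln (dμ/dπ))'|²]` on `ℝ`, for `π` with an
everywhere positive density.
It is `∞` unless `dμ/dπ` has a locally absolutely continuous version `f` (on the line this is the
same as weak differentiability of `dμ/dπ`). Such a version is unique, being continuous, so the
infimum runs over at most one function; `f` is positive `μ`-almost everywhere. -/
def fisherInfo (μ π : Measure ℝ) : ENNReal :=
  ⨅ (f : ℝ → ℝ) (_ : ∀ x, 0 ≤ f x) (_ : ∀ a b : ℝ, AbsolutelyContinuousOnInterval f a b)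
    (_ : μ = π.withDensity (fun x => ENNReal.ofReal (f x))),
    ∫⁻ x, ENNReal.ofReal ((deriv (fun y => Real.log (f y)) x) ^ 2) ∂μ

/-- A randomized adaptive algorithm that makes `n` queries to the local oracle. It has an internal
random seed and an unlimited supply of samples from the initialization oracle (a sequence
`ℕ → ℝ`). The query number `k` is a function of the seed, of the samples, and of the
history `(xᵢ, V xᵢ, V' xᵢ)`, `i < k`; the output is a function of the seed, of the samples, and of
the complete history. An algorithm that may stop earlier is covered, since it can be padded with
queries whose answers it ignores. -/
structure SamplingAlgorithm (n : ℕ) where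
  Seed : Type
  [seedSpace : MeasurableSpace Seed]
  seedLaw : Measure Seed
  [seedProb : IsProbabilityMeasure seedLaw]
  query : (k : ℕ) → Seed × (ℕ → ℝ) × (Fin k → ℝ × ℝ × ℝ) → ℝ
  measurable_query : ∀ k, Measurable (query k)
  output : Seed × (ℕ → ℝ) × (Fin n → ℝ × ℝ × ℝ) → ℝ
  measurable_output : Measurable output

attribute [instance] SamplingAlgorithm.seedSpace SamplingAlgorithm.seedProb

namespace SamplingAlgorithm

variable {n : ℕ}

/-- The first `k` query points with the oracle's answers, when the local oracle is that of the
potential `V`, the seed is `ζ` and the samples from the initialization oracle are `s`. -/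
def history (A : SamplingAlgorithm n) (V : ℝ → ℝ) (ζ : A.Seed) (s : ℕ → ℝ) :
    (k : ℕ) → Fin k → ℝ × ℝ × ℝ
  | 0 => Fin.elim0
  | k + 1 =>
    let x := A.query k (ζ, s, history A V ζ s k)
    Fin.snoc (α := fun _ => ℝ × ℝ × ℝ) (history A V ζ s k) (x, V x, deriv V x)

/-- The law of the output after the `n` queries, when the initialization oracle gives independent
samples from `μ₀`, which are also independent of the seed. -/
def outputLaw (A : SamplingAlgorithm n) (V : ℝ → ℝ) (μ₀ : Measure ℝ) [IsProbabilityMeasure μ₀] :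
    Measure ℝ :=
  (A.seedLaw.prod (Measure.infinitePi (fun _ : ℕ => μ₀))).map
    (fun p => A.output (p.1, p.2, A.history V p.1 p.2 n))

/-- For every `β`-log-smooth target `π ∝ exp (-V)` and every initialization `μ₀` with
`KL(μ₀ ‖ π) ≤ K₀`, the law `μ` of the output satisfies `√FI(μ ‖ π) ≤ ε`. As `V` ranges over all
potentials of `π`, the oracle's values are those of the potential up to an unknown constant. -/
def Succeeds (A : SamplingAlgorithm n) (K₀ ε β : ℝ) : Prop :=
  ∀ V : ℝ → ℝ, IsLogSmoothPotential β V →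
    ∀ (μ₀ : Measure ℝ) [IsProbabilityMeasure μ₀],
      InformationTheory.klDiv μ₀ (gibbs V) ≤ ENNReal.ofReal K₀ →
        (fisherInfo (A.outputLaw V μ₀) (gibbs V)) ^ (1 / 2 : ℝ) ≤ ENNReal.ofReal ε

end SamplingAlgorithm

/-- The query complexity on `ℝ`: the least number of queries to the local oracle with which some
algorithm succeeds (`⊤` if there is none). -/
def queryComplexity (K₀ ε β : ℝ) : ℕ∞ :=
  ⨅ (n : ℕ) (_ : ∃ A : SamplingAlgorithm n, A.Succeeds K₀ ε β), (n : ℕ∞)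

end FisherSampling

end

open scoped ENNReal

noncomputable section

namespace FisherSampling

/-! A needle in a haystack. Take a Gaussian of standard deviation `R`, of order `1/ε`, and dig into
its potential one well of width of order `L` somewhere in `[0, R]`, with depth `log (R / (2 * L))`,
so that the well holds a constant fraction of the mass. Smoothness only demands that `L ^ 2` be of
order `log R`, so there is room for about `1 / (ε * √log (1/ε))` disjoint wells.

The Gaussian itself is a legal initialization for every such target (`klDiv_le`), so the samples do
not reveal the well, and neither do queries that miss it. Hence `n` queries and one output meet at
most `n + 1` wells on average (`sum_outputLaw_le`).

Yet success requires hitting the well. If `f = dμ/dπ`, an `L¹` Poincaré inequality anchored at a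
point `m` gives `1 = ∫ f dπ ≤ f m + H * ∫ |f'| dπ`, and by Cauchy–Schwarz `∫ |f'| dπ = 𝔼_μ |(log
f)'| ≤ √FI`. Here `H` is of order `R`, because the well only adds mass and cannot create a
bottleneck. Thus `f ≥ 1/2` on the well, and `μ` gives it constant mass (`le_measure_core`).
Comparing the two counts bounds `n` below. -/

/-! ### Fisher information and the anchored `L¹` Poincaré inequality -/

/-- This is `f' = f * (log f)'`. A zero of `f` is a minimum, so `f'` vanishes there and the default
value of `log 0` does no harm; where `f` is not differentiable, `deriv f` is `0` by default. -/
theorem ofReal_abs_deriv_le {f : ℝ → ℝ} (hf : ∀ x, 0 ≤ f x) (x : ℝ) :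
    ENNReal.ofReal |deriv f x| ≤
      ENNReal.ofReal (f x) * ENNReal.ofReal |deriv (fun y => Real.log (f y)) x| := by
  rw [← ENNReal.ofReal_mul (hf x)]
  refine ENNReal.ofReal_le_ofReal ?_
  rcases (hf x).eq_or_lt with h | h
  · have : IsLocalMin f x := Filter.Eventually.of_forall fun y => h ▸ hf y
    simp [this.deriv_eq_zero, ← h]
  · by_cases hd : DifferentiableAt ℝ f x
    · rw [deriv.log hd h.ne', abs_div, abs_of_pos h, mul_div_cancel₀ _ h.ne']
    · rw [deriv_zero_of_not_differentiableAt hd, abs_zero]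
      positivity

theorem ofReal_le_add_lintegral_deriv {f : ℝ → ℝ}
    (hac : ∀ a b : ℝ, AbsolutelyContinuousOnInterval f a b) (m x : ℝ) :
    ENNReal.ofReal (f x) ≤
      ENNReal.ofReal (f m) + ∫⁻ y in Set.uIoc m x, ENNReal.ofReal |deriv f y| := by
  have h1 := (hac m x).integral_deriv_eq_sub
  have h2 : IntervalIntegrable (deriv f) volume m x := (hac m x).intervalIntegrable_deriv
  have h3 : IntegrableOn (deriv f) (Set.uIoc m x) := h2.def'
  have h4 : |f x - f m| ≤ ∫ y in Set.uIoc m x, |deriv f y| := by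
    rw [← h1]
    simpa [Real.norm_eq_abs] using
      intervalIntegral.norm_integral_le_integral_norm_uIoc (f := deriv f) (a := m) (b := x)
        (μ := volume)
  have h5 : ENNReal.ofReal (∫ y in Set.uIoc m x, |deriv f y|) =
      ∫⁻ y in Set.uIoc m x, ENNReal.ofReal |deriv f y| :=
    ofReal_integral_eq_lintegral_ofReal h3.abs (ae_of_all _ fun _ => abs_nonneg _)
  calc ENNReal.ofReal (f x) ≤ ENNReal.ofReal (f m + |f x - f m|) :=
        ENNReal.ofReal_le_ofReal (by linarith [le_abs_self (f x - f m)])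
    _ ≤ ENNReal.ofReal (f m) + ENNReal.ofReal |f x - f m| := ENNReal.ofReal_add_le
    _ ≤ _ := by
        rw [← h5]
        gcongr

/-- The `L¹` Poincaré inequality on the line, anchored at a point `m`, from the isoperimetric
inequality for the half-lines that point away from `m`. -/
theorem lintegral_le_add_lintegral_deriv {p : ℝ → ℝ≥0∞} (hp : Measurable p)
    [IsProbabilityMeasure (volume.withDensity p)] {f : ℝ → ℝ}
    (hac : ∀ a b : ℝ, AbsolutelyContinuousOnInterval f a b) {H : ℝ≥0∞} {m : ℝ}
    (hr : ∀ y, m ≤ y → volume.withDensity p (Set.Ici y) ≤ H * p y)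
    (hl : ∀ y, y ≤ m → volume.withDensity p (Set.Iic y) ≤ H * p y) :
    ∫⁻ x, ENNReal.ofReal (f x) ∂(volume.withDensity p) ≤ ENNReal.ofReal (f m) +
      H * ∫⁻ y, ENNReal.ofReal |deriv f y| ∂(volume.withDensity p) := by
  set π := volume.withDensity p with hπ
  set g : ℝ → ℝ≥0∞ := fun y => ENNReal.ofReal |deriv f y| with hg
  have hgm : Measurable g := (measurable_deriv f).abs.ennreal_ofReal
  have hS : MeasurableSet {q : ℝ × ℝ | q.2 ∈ Set.uIoc m q.1} := by
    have : {q : ℝ × ℝ | q.2 ∈ Set.uIoc m q.1} =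
        {q : ℝ × ℝ | min m q.1 < q.2} ∩ {q : ℝ × ℝ | q.2 ≤ max m q.1} := rfl
    rw [this]
    exact (measurableSet_lt (by fun_prop) (by fun_prop)).inter
      (measurableSet_le (by fun_prop) (by fun_prop))
  set F : ℝ → ℝ → ℝ≥0∞ := fun x y => (Set.uIoc m x).indicator g y with hF
  have hFm : Measurable (Function.uncurry F) :=
    (hgm.comp measurable_snd).indicator hS
  have hinner : ∀ y, ∫⁻ x, F x y ∂π ≤ g y * (H * p y) := by
    intro y
    have hset : MeasurableSet {x | y ∈ Set.uIoc m x} := by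
      exact (measurable_id.prodMk measurable_const) hS
    have : (fun x => F x y) = {x | y ∈ Set.uIoc m x}.indicator fun _ => g y := by
      ext x
      by_cases h : y ∈ Set.uIoc m x <;> simp [hF, h]
    rw [this, lintegral_indicator_const hset]
    gcongr
    -- For fixed `y`, the `x` with `y` between `m` and `x` lie in the half-line from `y` pointing
    -- away from `m`.
    rcases lt_or_ge m y with h | h
    · refine (measure_mono ?_).trans (hr y h.le)
      intro x hx
      rcases (Set.mem_uIoc.1 hx) with hx | hx
      · exact hx.2
      · exact absurd hx.2 (not_le.2 h)
    · refine (measure_mono ?_).trans (hl y h)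
      intro x hx
      rcases (Set.mem_uIoc.1 hx) with hx | hx
      · exact absurd hx.1 (not_lt.2 h)
      · exact hx.1.le
  calc ∫⁻ x, ENNReal.ofReal (f x) ∂π
      ≤ ∫⁻ x, (ENNReal.ofReal (f m) + (∫⁻ y, F x y)) ∂π := by
        refine lintegral_mono fun x => ?_
        simp only [hF]
        rw [lintegral_indicator measurableSet_uIoc]
        exact ofReal_le_add_lintegral_deriv hac m x
    _ = ENNReal.ofReal (f m) + ∫⁻ x, (∫⁻ y, F x y) ∂π := by
        rw [lintegral_add_left measurable_const]
        simp
    _ = ENNReal.ofReal (f m) + ∫⁻ y, (∫⁻ x, F x y ∂π) := by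
        rw [lintegral_lintegral_swap hFm.aemeasurable]
    _ ≤ ENNReal.ofReal (f m) + ∫⁻ y, g y * (H * p y) := by
        gcongr with y
        exact hinner y
    _ = _ := by
        rw [hπ, lintegral_withDensity_eq_lintegral_mul _ hp hgm,
          ← lintegral_const_mul _ (hp.mul hgm)]
        congr 2 with y
        simp only [Pi.mul_apply]
        ring

/-- A small Fisher information forces the density `f = dμ/dπ` to be bounded below at every point
`m` that sees an isoperimetric inequality. -/
theorem one_le_density_add_fisherInfo {p : ℝ → ℝ≥0∞} (hp : Measurable p)
    [IsProbabilityMeasure (volume.withDensity p)] {f : ℝ → ℝ} (hf : ∀ x, 0 ≤ f x)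
    (hac : ∀ a b : ℝ, AbsolutelyContinuousOnInterval f a b) {μ : Measure ℝ}
    [IsProbabilityMeasure μ]
    (hμ : μ = (volume.withDensity p).withDensity (fun x => ENNReal.ofReal (f x)))
    {H : ℝ≥0∞} {m : ℝ}
    (hr : ∀ y, m ≤ y → volume.withDensity p (Set.Ici y) ≤ H * p y)
    (hl : ∀ y, y ≤ m → volume.withDensity p (Set.Iic y) ≤ H * p y) :
    1 ≤ ENNReal.ofReal (f m) + H *
      (∫⁻ x, ENNReal.ofReal ((deriv (fun y => Real.log (f y)) x) ^ 2) ∂μ) ^ (1 / 2 : ℝ) := by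
  have hfc : Continuous f := by
    refine continuous_iff_continuousAt.2 fun x => ?_
    refine (hac (x - 1) (x + 1)).continuousOn.continuousAt ?_
    rw [Set.uIcc_of_le (by linarith)]
    exact Icc_mem_nhds (by linarith) (by linarith)
  have hfm : Measurable fun x => ENNReal.ofReal (f x) := hfc.measurable.ennreal_ofReal
  set l : ℝ → ℝ := deriv (fun y => Real.log (f y))
  have hlm : Measurable l := measurable_deriv _
  have h1 : ∫⁻ x, ENNReal.ofReal (f x) ∂(volume.withDensity p) = 1 := by
    have := measure_univ (μ := μ)
    rwa [hμ, withDensity_apply _ MeasurableSet.univ, setLIntegral_univ] at this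
  have hcs : ∫⁻ x, ENNReal.ofReal |l x| ∂μ ≤
      (∫⁻ x, ENNReal.ofReal (l x ^ 2) ∂μ) ^ (1 / 2 : ℝ) := by
    have := ENNReal.lintegral_mul_le_Lp_mul_Lq μ Real.HolderConjugate.two_two
      (f := fun x => ENNReal.ofReal |l x|) (g := fun _ => 1)
      hlm.abs.ennreal_ofReal.aemeasurable aemeasurable_const
    simp only [Pi.mul_apply, mul_one, ENNReal.one_rpow, lintegral_const, measure_univ] at this
    refine this.trans_eq ?_
    congr 2 with x
    rw [ENNReal.ofReal_rpow_of_nonneg (abs_nonneg _) (by norm_num)]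
    simp
  calc (1 : ℝ≥0∞) ≤ ENNReal.ofReal (f m) +
        H * ∫⁻ y, ENNReal.ofReal |deriv f y| ∂(volume.withDensity p) :=
        h1 ▸ lintegral_le_add_lintegral_deriv hp hac hr hl
    _ ≤ ENNReal.ofReal (f m) + H * ∫⁻ x, ENNReal.ofReal |l x| ∂μ := by
        refine add_le_add le_rfl (mul_le_mul_right ?_ H)
        rw [hμ, lintegral_withDensity_eq_lintegral_mul _ hfm hlm.abs.ennreal_ofReal]
        exact lintegral_mono fun x => ofReal_abs_deriv_le hf x
    _ ≤ _ := by gcongr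

/-! ### The Gaussian potential and its wells -/

/-- A smooth bump, equal to `1` on `[-1, 1]` and supported in `[-2, 2]`. -/
def bump : ContDiffBump (0 : ℝ) := ⟨1, 2, one_pos, one_lt_two⟩

theorem exists_lipschitz_deriv_bump :
    ∃ B : ℝ, 1 ≤ B ∧ ∀ x y : ℝ, |deriv bump x - deriv bump y| ≤ B * |x - y| := by
  have h2 : ContDiff ℝ 2 (bump : ℝ → ℝ) := bump.contDiff
  have h1 : ContDiff ℝ 1 (deriv (bump : ℝ → ℝ)) :=
    ((contDiff_succ_iff_deriv (n := 1)).1 (by simpa [one_add_one_eq_two] using h2)).2.2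
  obtain ⟨C, hC⟩ := h1.lipschitzWith_of_hasCompactSupport bump.hasCompactSupport.deriv one_ne_zero
  refine ⟨max 1 C, le_max_left _ _, fun x y => ?_⟩
  have := hC.dist_le_mul x y
  rw [Real.dist_eq, Real.dist_eq] at this
  exact this.trans (mul_le_mul_of_nonneg_right (le_max_right _ _) (abs_nonneg _))

/-- The quadratic potential of the centered Gaussian with variance `R ^ 2`. -/
def basePotential (R x : ℝ) : ℝ := x ^ 2 / (2 * R ^ 2)

/-- The profile of a well of half-width `2 * L` around `a`, whose depth `log (R / (2 * L))` is such
that it captures a constant fraction of the mass. -/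
def well (R L a x : ℝ) : ℝ := Real.log (R / (2 * L)) * bump ((x - a) / L)

/-- The quadratic potential with a well dug around `a`. -/
def wellPotential (R L a x : ℝ) : ℝ := basePotential R x - well R L a x

theorem contDiff_basePotential (R : ℝ) : ContDiff ℝ 2 (basePotential R) := by
  unfold basePotential
  fun_prop

theorem contDiff_well (R L a : ℝ) : ContDiff ℝ 2 (well R L a) := by
  unfold well
  have h2 : ContDiff ℝ 2 (bump : ℝ → ℝ) := bump.contDiff
  exact contDiff_const.mul (h2.comp (by fun_prop))

theorem contDiff_wellPotential (R L a : ℝ) : ContDiff ℝ 2 (wellPotential R L a) :=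
  (contDiff_basePotential R).sub (contDiff_well R L a)

theorem deriv_wellPotential (R L a x : ℝ) :
    deriv (wellPotential R L a) x =
      x / R ^ 2 - Real.log (R / (2 * L)) * (deriv bump ((x - a) / L) * (1 / L)) := by
  have h2 : ContDiff ℝ 2 (bump : ℝ → ℝ) := bump.contDiff
  have hb : HasDerivAt (bump : ℝ → ℝ) (deriv bump ((x - a) / L)) ((x - a) / L) :=
    ((h2.differentiable (by norm_num)) _).hasDerivAt
  have hl : HasDerivAt (fun x => (x - a) / L) (1 / L) x :=
    ((hasDerivAt_id x).sub_const a).div_const L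
  have hq : HasDerivAt (basePotential R) (x / R ^ 2) x := by
    have := ((hasDerivAt_id x).pow 2).div_const (2 * R ^ 2)
    refine this.congr_deriv ?_
    simp
    ring
  exact (hq.sub ((hb.comp x hl).const_mul (Real.log (R / (2 * L))))).deriv

theorem integral_exp_neg_basePotential {R : ℝ} (hR : 0 < R) :
    ∫ x, Real.exp (-basePotential R x) = Real.sqrt (2 * Real.pi) * R := by
  have := integral_gaussian (1 / (2 * R ^ 2))
  rw [show Real.pi / (1 / (2 * R ^ 2)) = (2 * Real.pi) * R ^ 2 by field_simp,
    Real.sqrt_mul (by positivity), Real.sqrt_sq hR.le] at this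
  rw [← this]
  congr 1 with x
  unfold basePotential
  congr 1
  ring

theorem integrable_exp_neg_basePotential {R : ℝ} (hR : 0 < R) :
    Integrable fun x => Real.exp (-basePotential R x) := by
  have := integrable_exp_neg_mul_sq (b := 1 / (2 * R ^ 2)) (by positivity)
  refine this.congr (ae_of_all _ fun x => ?_)
  simp only [basePotential]
  congr 1
  ring

theorem integral_exp_neg_basePotential_bounds {R : ℝ} (hR : 0 < R) :
    2 * R ≤ ∫ x, Real.exp (-basePotential R x) ∧
      ∫ x, Real.exp (-basePotential R x) ≤ 13 / 5 * R := by
  rw [integral_exp_neg_basePotential hR]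
  have h1 : 2 ≤ Real.sqrt (2 * Real.pi) := by
    apply Real.le_sqrt_of_sq_le
    nlinarith [Real.pi_gt_three]
  have h2 : Real.sqrt (2 * Real.pi) ≤ 13 / 5 := by
    rw [Real.sqrt_le_left (by norm_num)]
    nlinarith [Real.pi_lt_d2]
  exact ⟨by gcongr, by gcongr⟩

/-! ### One well: normalization, smoothness, and divergence from the Gaussian -/

/-- The geometry of a well: it lies in `[0, R]` and is not too wide. -/
structure IsWell (R L a : ℝ) : Prop where
  pos : 0 < L
  wide : 2 * L ≤ R
  left : 2 * L ≤ a
  right : a + 2 * L ≤ R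

namespace IsWell

variable {R L a : ℝ}

theorem radius_pos (hw : IsWell R L a) : 0 < R := by linarith [hw.pos, hw.wide]

theorem depth_nonneg (hw : IsWell R L a) : 0 ≤ Real.log (R / (2 * L)) := by
  apply Real.log_nonneg
  rw [one_le_div (by linarith [hw.pos])]
  exact hw.wide

theorem exp_depth (hw : IsWell R L a) : Real.exp (Real.log (R / (2 * L))) = R / (2 * L) :=
  Real.exp_log (div_pos hw.radius_pos (by linarith [hw.pos]))

theorem well_nonneg (hw : IsWell R L a) (x : ℝ) : 0 ≤ well R L a x :=
  mul_nonneg hw.depth_nonneg bump.nonneg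

theorem well_le (hw : IsWell R L a) (x : ℝ) : well R L a x ≤ Real.log (R / (2 * L)) :=
  mul_le_of_le_one_right hw.depth_nonneg bump.le_one

theorem well_eq (hw : IsWell R L a) {x : ℝ} (hx : x ∈ Set.Icc (a - L) (a + L)) :
    well R L a x = Real.log (R / (2 * L)) := by
  unfold well
  rw [bump.one_of_mem_closedBall, mul_one]
  rw [mem_closedBall_zero_iff, Real.norm_eq_abs, abs_div, abs_of_pos hw.pos]
  refine (div_le_one hw.pos).2 (abs_le.2 ⟨?_, ?_⟩) <;> linarith [hx.1, hx.2]

theorem well_eq_zero (hw : IsWell R L a) {x : ℝ}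
    (hx : x ∉ Set.Icc (a - 2 * L) (a + 2 * L)) : well R L a x = 0 := by
  unfold well
  rw [bump.zero_of_le_dist, mul_zero]
  change 2 ≤ _
  rw [Real.dist_eq, sub_zero, abs_div, abs_of_pos hw.pos, le_div_iff₀ hw.pos]
  by_contra! h
  rw [abs_lt] at h
  exact hx ⟨by linarith, by linarith⟩

theorem wellPotential_eq (hw : IsWell R L a) {x : ℝ}
    (hx : x ∉ Set.Icc (a - 2 * L) (a + 2 * L)) : wellPotential R L a x = basePotential R x := by
  rw [wellPotential, hw.well_eq_zero hx, sub_zero]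

theorem deriv_wellPotential_eq (hw : IsWell R L a) {x : ℝ}
    (hx : x ∉ Set.Icc (a - 2 * L) (a + 2 * L)) :
    deriv (wellPotential R L a) x = deriv (basePotential R) x := by
  apply Filter.EventuallyEq.deriv_eq
  filter_upwards [isClosed_Icc.isOpen_compl.mem_nhds hx] with y hy
  exact hw.wellPotential_eq hy

theorem exp_neg_le (hw : IsWell R L a) (x : ℝ) :
    Real.exp (-basePotential R x) ≤ Real.exp (-wellPotential R L a x) := by
  rw [wellPotential]
  exact Real.exp_le_exp.2 (by linarith [hw.well_nonneg x])

theorem integrable (hw : IsWell R L a) :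
    Integrable fun x => Real.exp (-wellPotential R L a x) := by
  refine ((integrable_exp_neg_basePotential hw.radius_pos).mul_const
    (Real.exp (Real.log (R / (2 * L))))).mono' ?_ (ae_of_all _ fun x => ?_)
  · exact (Real.continuous_exp.comp
      (contDiff_wellPotential R L a).continuous.neg).aestronglyMeasurable
  · rw [Real.norm_eq_abs, Real.abs_exp, ← Real.exp_add, wellPotential]
    exact Real.exp_le_exp.2 (by linarith [hw.well_le x])

/-- The well adds at most `R / (2 * L)` to the unnormalized density on an interval of length `4 *
L`, hence at most `2 * R` in total, which the Gaussian integral dominates. -/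
theorem integral_le (hw : IsWell R L a) :
    ∫ x, Real.exp (-wellPotential R L a x) ≤ 2 * ∫ x, Real.exp (-basePotential R x) := by
  have hb := integrable_exp_neg_basePotential hw.radius_pos
  have hi : Integrable ((Set.Icc (a - 2 * L) (a + 2 * L)).indicator fun _ => R / (2 * L)) :=
    (integrable_indicator_iff measurableSet_Icc).2
      (integrableOn_const (by simp) (by simp))
  have h1 : ∫ x, Real.exp (-wellPotential R L a x) ≤ ∫ x, (Real.exp (-basePotential R x) +
      (Set.Icc (a - 2 * L) (a + 2 * L)).indicator (fun _ => R / (2 * L)) x) := by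
    refine integral_mono hw.integrable (hb.add hi) fun x => ?_
    by_cases hx : x ∈ Set.Icc (a - 2 * L) (a + 2 * L)
    · simp only [Set.indicator_of_mem hx]
      have h0 : 0 ≤ basePotential R x := by unfold basePotential; positivity
      have : Real.exp (-wellPotential R L a x) ≤ R / (2 * L) := by
        rw [← hw.exp_depth, wellPotential]
        exact Real.exp_le_exp.2 (by linarith [hw.well_le x])
      linarith [Real.exp_pos (-basePotential R x)]
    · simp only [Set.indicator_of_notMem hx, add_zero]
      rw [hw.wellPotential_eq hx]
  rw [integral_add hb hi, integral_indicator measurableSet_Icc, setIntegral_const] at h1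
  have h2 : volume.real (Set.Icc (a - 2 * L) (a + 2 * L)) • (R / (2 * L)) = 2 * R := by
    have := hw.pos
    rw [Real.volume_real_Icc_of_le (by linarith), smul_eq_mul]
    field_simp
    ring
  rw [h2] at h1
  linarith [(integral_exp_neg_basePotential_bounds hw.radius_pos).1]

theorem integral_pos (hw : IsWell R L a) : 0 < ∫ x, Real.exp (-wellPotential R L a x) :=
  integral_exp_pos hw.integrable

/-- The smoothness budget is split in halves: the Gaussian costs `1 / R ^ 2 ≤ 1/4`, and the well
costs `B / L ^ 2` times its depth. -/
theorem isLogSmoothPotential (hw : IsWell R L a) (hR : 2 ≤ R) {B : ℝ}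
    (hB : ∀ x y : ℝ, |deriv bump x - deriv bump y| ≤ B * |x - y|)
    (hL : B * Real.log (R / (2 * L)) ≤ L ^ 2 / 2) :
    IsLogSmoothPotential 1 (wellPotential R L a) where
  contDiff := contDiff_wellPotential R L a
  integrable := hw.integrable
  deriv_lipschitz x y := by
    have hLp := hw.pos
    set h := Real.log (R / (2 * L)) with hh
    have h0 : 0 ≤ h := hw.depth_nonneg
    rw [deriv_wellPotential, deriv_wellPotential, ← hh]
    have e : x / R ^ 2 - h * (deriv bump ((x - a) / L) * (1 / L)) -
        (y / R ^ 2 - h * (deriv bump ((y - a) / L) * (1 / L))) =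
        (x - y) / R ^ 2 - h / L * (deriv bump ((x - a) / L) - deriv bump ((y - a) / L)) := by
      ring
    have h1 : |(x - y) / R ^ 2| ≤ 1 / 2 * |x - y| := by
      rw [abs_div, abs_of_pos (by positivity : 0 < R ^ 2), div_le_iff₀ (by positivity)]
      have : 4 ≤ R ^ 2 := by nlinarith
      nlinarith [mul_le_mul_of_nonneg_left this (abs_nonneg (x - y)), abs_nonneg (x - y)]
    have h2 : |h / L * (deriv bump ((x - a) / L) - deriv bump ((y - a) / L))| ≤
        1 / 2 * |x - y| := by
      rw [abs_mul, abs_of_nonneg (by positivity : 0 ≤ h / L)]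
      calc h / L * |deriv bump ((x - a) / L) - deriv bump ((y - a) / L)|
          ≤ h / L * (B * |(x - a) / L - (y - a) / L|) := by gcongr; exact hB _ _
        _ = B * h / L ^ 2 * |x - y| := by
            rw [← sub_div, abs_div, abs_of_pos hLp, show x - a - (y - a) = x - y by ring]
            field_simp
        _ ≤ 1 / 2 * |x - y| := by
            refine mul_le_mul_of_nonneg_right ?_ (abs_nonneg _)
            rw [div_le_iff₀ (by positivity)]
            linarith
    rw [e]
    calc _ ≤ _ := abs_sub _ _
      _ ≤ 1 * |x - y| := by linarith

theorem gibbs_basePotential (hw : IsWell R L a) :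
    gibbs (basePotential R) = (gibbs (wellPotential R L a)).tilted (fun x => -well R L a x) := by
  rw [gibbs, gibbs, tilted_tilted hw.integrable]
  congr 1
  ext x
  simp only [wellPotential, Pi.add_apply]
  ring

/-- The Gaussian is the target tilted by `-well`, so its log-density is `-well` plus the log of the
ratio of normalizing constants. The first term is nonpositive and the ratio is at most `2`. -/
theorem klDiv_le (hw : IsWell R L a) :
    InformationTheory.klDiv (gibbs (basePotential R)) (gibbs (wellPotential R L a)) ≤
      ENNReal.ofReal 1 := by
  set ν := gibbs (wellPotential R L a) with hν
  have : IsProbabilityMeasure ν := isProbabilityMeasure_tilted hw.integrable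
  have hwm : AEMeasurable (fun x => -well R L a x) ν :=
    (contDiff_well R L a).continuous.neg.aemeasurable
  have hexp : Integrable (fun x => Real.exp (-well R L a x)) ν := by
    refine Integrable.of_bound hwm.exp.aestronglyMeasurable 1
      (ae_of_all _ fun x => ?_)
    rw [Real.norm_eq_abs, Real.abs_exp]
    exact Real.exp_le_one_iff.2 (by linarith [hw.well_nonneg x])
  have hI : ∫ x, Real.exp (-well R L a x) ∂ν =
      (∫ x, Real.exp (-basePotential R x)) / ∫ x, Real.exp (-wellPotential R L a x) := by
    rw [hν, gibbs, integral_exp_tilted]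
    congr 3 with x
    simp only [wellPotential, Pi.add_apply]
    ring_nf
  have hI2 : 1 / 2 ≤ ∫ x, Real.exp (-well R L a x) ∂ν := by
    rw [hI, le_div_iff₀ hw.integral_pos]
    linarith [hw.integral_le]
  have hllr : llr (ν.tilted fun x => -well R L a x) ν =ᵐ[ν.tilted fun x => -well R L a x]
      fun x => -well R L a x - Real.log (∫ x, Real.exp (-well R L a x) ∂ν) :=
    (tilted_absolutelyContinuous ν _).ae_le (log_rnDeriv_tilted_left_self hexp)
  rw [hw.gibbs_basePotential, ← hν]
  have : IsProbabilityMeasure (ν.tilted fun x => -well R L a x) :=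
    isProbabilityMeasure_tilted hexp
  have hint : Integrable
      (fun x => -well R L a x - Real.log (∫ x, Real.exp (-well R L a x) ∂ν))
      (ν.tilted fun x => -well R L a x) := by
    refine Integrable.sub (Integrable.of_bound
      (contDiff_well R L a).continuous.neg.aestronglyMeasurable
      (Real.log (R / (2 * L))) (ae_of_all _ fun x => ?_)) (integrable_const _)
    rw [norm_neg, Real.norm_eq_abs, abs_of_nonneg (hw.well_nonneg x)]
    exact hw.well_le x
  rw [InformationTheory.klDiv_of_ac_of_integrable (tilted_absolutelyContinuous ν _)
    ((integrable_congr hllr).2 hint), integral_congr_ae hllr]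
  refine ENNReal.ofReal_le_ofReal ?_
  simp only [probReal_univ, add_sub_cancel_right]
  have hlog : -1 ≤ Real.log (∫ x, Real.exp (-well R L a x) ∂ν) := by
    have h1 := Real.log_le_log (by norm_num) hI2
    rw [one_div, Real.log_inv] at h1
    linarith [Real.log_two_lt_d9]
  calc _ ≤ ∫ _, (1 : ℝ) ∂(ν.tilted fun x => -well R L a x) :=
        integral_mono hint (integrable_const _) fun x => by
          have := hw.well_nonneg x
          simp only
          linarith
    _ = 1 := by simp

/-! ### Isoperimetry of the target and the mass of the well -/

/-- The density of the Gibbs measure of a potential with a well. -/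
def density (R L a x : ℝ) : ℝ≥0∞ :=
  ENNReal.ofReal (Real.exp (-wellPotential R L a x) / ∫ x, Real.exp (-wellPotential R L a x))

theorem measurable_density : Measurable (density R L a) :=
  ((Real.continuous_exp.comp
    (contDiff_wellPotential R L a).continuous.neg).div_const _).measurable.ennreal_ofReal

theorem half_le_exp_neg_basePotential (hR : 0 < R) {x : ℝ} (hx : |x| ≤ R) :
    1 / 2 ≤ Real.exp (-basePotential R x) := by
  have : basePotential R x ≤ 1 / 2 := by
    unfold basePotential
    rw [div_le_iff₀ (by positivity)]
    nlinarith [sq_le_sq' (by linarith [(abs_le.1 hx).1]) (abs_le.1 hx).2]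
  linarith [Real.add_one_le_exp (-basePotential R x)]

theorem le_density_of_abs_le (hw : IsWell R L a) {y : ℝ} (hy : |y| ≤ R) :
    1 ≤ ENNReal.ofReal (4 * ∫ x, Real.exp (-basePotential R x)) * density R L a y := by
  have h0 := (integral_exp_neg_basePotential_bounds hw.radius_pos).1
  have hR := hw.radius_pos
  rw [density, ← ENNReal.ofReal_mul (by linarith), ENNReal.one_le_ofReal, ← mul_div_assoc,
    one_le_div hw.integral_pos]
  have h1 := half_le_exp_neg_basePotential hR hy
  have h2 := hw.exp_neg_le y
  nlinarith [hw.integral_le]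

/-- Beyond `R` the density is purely Gaussian, and the quadratic inequality bounds its value at `x`
by its value at `y` times the unnormalized Gaussian at `x - y`, which is then integrated over the
line. The form of `hS'` serves both tails. -/
theorem withDensity_tail_le (hw : IsWell R L a) {y : ℝ} (hy : R < |y|) {S : Set ℝ}
    (hS : MeasurableSet S) (hS' : ∀ x ∈ S, R < |x| ∧ y ^ 2 + (x - y) ^ 2 ≤ x ^ 2) :
    volume.withDensity (density R L a) S ≤
      ENNReal.ofReal (4 * ∫ x, Real.exp (-basePotential R x)) * density R L a y := by
  have hR := hw.radius_pos
  have hout : ∀ x, R < |x| → x ∉ Set.Icc (a - 2 * L) (a + 2 * L) := by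
    intro x hx hx'
    rw [abs_of_nonneg (by linarith [hx'.1, hw.left])] at hx
    linarith [hx'.2, hw.right]
  set Z := ∫ x, Real.exp (-wellPotential R L a x) with hZ
  have hZp : 0 < Z := hw.integral_pos
  have h0 := (integral_exp_neg_basePotential_bounds hR).1
  have hmeas : Measurable fun x => ENNReal.ofReal (Real.exp (-basePotential R x)) :=
    (Real.continuous_exp.comp (contDiff_basePotential R).continuous.neg).measurable.ennreal_ofReal
  rw [withDensity_apply _ hS]
  calc ∫⁻ x in S, density R L a x
      ≤ ∫⁻ x in S, density R L a y * ENNReal.ofReal (Real.exp (-basePotential R (x - y))) := by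
        refine setLIntegral_mono' hS fun x hx => ?_
        obtain ⟨h1, h2⟩ := hS' x hx
        rw [density, density, ← hZ, hw.wellPotential_eq (hout x h1), hw.wellPotential_eq (hout y hy),
          ← ENNReal.ofReal_mul (by positivity), div_mul_eq_mul_div, ← Real.exp_add]
        refine ENNReal.ofReal_le_ofReal ?_
        gcongr
        unfold basePotential
        rw [← neg_add, neg_le_neg_iff, ← add_div]
        gcongr
    _ ≤ ∫⁻ x, density R L a y * ENNReal.ofReal (Real.exp (-basePotential R (x - y))) :=
        setLIntegral_le_lintegral _ _
    _ = density R L a y * ENNReal.ofReal (∫ x, Real.exp (-basePotential R x)) := by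
        have hmy : Measurable fun x => ENNReal.ofReal (Real.exp (-basePotential R (x - y))) :=
          hmeas.comp (measurable_id.sub_const y)
        rw [lintegral_const_mul _ hmy,
          lintegral_sub_right_eq_self
            (fun x => ENNReal.ofReal (Real.exp (-basePotential R x))) y,
          ofReal_integral_eq_lintegral_ofReal (integrable_exp_neg_basePotential hR)
            (ae_of_all _ fun _ => (Real.exp_pos _).le)]
    _ ≤ _ := by
        rw [mul_comm]
        gcongr
        linarith

theorem gibbs_wellPotential : gibbs (wellPotential R L a) = volume.withDensity (density R L a) :=
  rfl

/-- Within `[-R, R]` the density is so large that the trivial bound `1` on the mass suffices; past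
`R` the Gaussian tail takes over. The condition on `m` excludes `y < -R`, where the half-line would
contain the bulk. -/
theorem isoperimetry_right (hw : IsWell R L a) {m y : ℝ} (hm : 0 ≤ m) (hy : m ≤ y) :
    volume.withDensity (density R L a) (Set.Ici y) ≤
      ENNReal.ofReal (4 * ∫ x, Real.exp (-basePotential R x)) * density R L a y := by
  have : IsProbabilityMeasure (volume.withDensity (density R L a)) :=
    isProbabilityMeasure_tilted hw.integrable
  have hy0 := hm.trans hy
  rcases le_or_gt |y| R with h | h
  · exact prob_le_one.trans (hw.le_density_of_abs_le h)
  · refine hw.withDensity_tail_le h measurableSet_Ici fun x hx => ?_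
    have hx : y ≤ x := hx
    refine ⟨h.trans_le ?_, by nlinarith⟩
    rwa [abs_of_nonneg hy0, abs_of_nonneg (hy0.trans hx)]

theorem isoperimetry_left (hw : IsWell R L a) {m y : ℝ} (hm : m ≤ R) (hy : y ≤ m) :
    volume.withDensity (density R L a) (Set.Iic y) ≤
      ENNReal.ofReal (4 * ∫ x, Real.exp (-basePotential R x)) * density R L a y := by
  have : IsProbabilityMeasure (volume.withDensity (density R L a)) :=
    isProbabilityMeasure_tilted hw.integrable
  rcases le_or_gt |y| R with h | h
  · exact prob_le_one.trans (hw.le_density_of_abs_le h)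
  · have hy0 : y ≤ 0 := by
      by_contra! h0
      rw [abs_of_pos h0] at h
      linarith
    refine hw.withDensity_tail_le h measurableSet_Iic fun x hx => ?_
    have hx : x ≤ y := hx
    refine ⟨h.trans_le ?_, by nlinarith⟩
    rw [abs_of_nonpos hy0, abs_of_nonpos (hx.trans hy0)]
    linarith

/-- On the core the unnormalized density is at least `R / (2 * L) * (1 / 2)` and the normalizing
constant is at most `2 * (13 / 5) * R`. The quotient `5 / 104 / L` over length `2 * L` gives `10 /
104 ≥ 1 / 11`. -/
theorem core_mass (hw : IsWell R L a) :
    ENNReal.ofReal (1 / 11) ≤ gibbs (wellPotential R L a) (Set.Icc (a - L) (a + L)) := by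
  have hL := hw.pos
  have hR := hw.radius_pos
  rw [gibbs_wellPotential, withDensity_apply _ measurableSet_Icc]
  calc ENNReal.ofReal (1 / 11)
      ≤ ENNReal.ofReal (5 / 104 / L) * volume (Set.Icc (a - L) (a + L)) := by
        rw [Real.volume_Icc, ← ENNReal.ofReal_mul (by positivity)]
        refine ENNReal.ofReal_le_ofReal ?_
        rw [show 5 / 104 / L * (a + L - (a - L)) = 10 / 104 by
          rw [add_sub_sub_cancel]
          field_simp
          norm_num]
        norm_num
    _ = ∫⁻ _ in Set.Icc (a - L) (a + L), ENNReal.ofReal (5 / 104 / L) := by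
        rw [setLIntegral_const]
    _ ≤ _ := by
        refine setLIntegral_mono' measurableSet_Icc fun x hx => ENNReal.ofReal_le_ofReal ?_
        rw [le_div_iff₀ hw.integral_pos]
        have h1 : 1 / 2 ≤ Real.exp (-basePotential R x) := by
          refine half_le_exp_neg_basePotential hR (abs_le.2 ⟨?_, ?_⟩) <;>
            linarith [hx.1, hx.2, hw.left, hw.right]
        have h2 : Real.exp (-wellPotential R L a x) =
            R / (2 * L) * Real.exp (-basePotential R x) := by
          rw [wellPotential, hw.well_eq hx, neg_sub, sub_eq_add_neg, Real.exp_add, hw.exp_depth]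
        rw [h2]
        calc 5 / 104 / L * ∫ x, Real.exp (-wellPotential R L a x)
            ≤ 5 / 104 / L * (2 * (13 / 5 * R)) := by
              gcongr
              linarith [hw.integral_le, (integral_exp_neg_basePotential_bounds hR).2]
          _ = R / (2 * L) * (1 / 2) := by field_simp; norm_num
          _ ≤ _ := by gcongr

/-- A law with small Fisher information relative to the target puts mass on the well. -/
theorem le_measure_core (hw : IsWell R L a) {ε : ℝ} (hε : 0 < ε) (hRε : R * ε ≤ 1 / 44)
    {μ : Measure ℝ} [IsProbabilityMeasure μ]
    (hμ : fisherInfo μ (gibbs (wellPotential R L a)) ^ (1 / 2 : ℝ) ≤ ENNReal.ofReal ε) :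
    ENNReal.ofReal (1 / 22) ≤ μ (Set.Icc (a - L) (a + L)) := by
  have hR := hw.radius_pos
  have hL := hw.pos
  -- Doubling `ε` makes the bound strict, so that a density `f` can be extracted from the infimum.
  have hlt : fisherInfo μ (gibbs (wellPotential R L a)) < ENNReal.ofReal (2 * ε) ^ (2 : ℝ) := by
    have h1 : fisherInfo μ (gibbs (wellPotential R L a)) ^ (1 / 2 : ℝ) < ENNReal.ofReal (2 * ε) :=
      hμ.trans_lt ((ENNReal.ofReal_lt_ofReal_iff (by linarith)).2 (by linarith))
    have h2 := ENNReal.rpow_lt_rpow h1 (by norm_num : (0 : ℝ) < 2)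
    rwa [← ENNReal.rpow_mul, show (1 / 2 : ℝ) * 2 = 1 by norm_num, ENNReal.rpow_one] at h2
  unfold fisherInfo at hlt
  simp only [iInf_lt_iff] at hlt
  obtain ⟨f, hf, hac, hμf, hI⟩ := hlt
  have : IsProbabilityMeasure (volume.withDensity (density R L a)) :=
    isProbabilityMeasure_tilted hw.integrable
  have hI' : (∫⁻ x, ENNReal.ofReal ((deriv (fun y => Real.log (f y)) x) ^ 2) ∂μ) ^ (1 / 2 : ℝ) ≤
      ENNReal.ofReal (2 * ε) := by
    refine (ENNReal.rpow_le_rpow hI.le (by norm_num)).trans_eq ?_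
    rw [← ENNReal.rpow_mul]
    norm_num
  have hhalf : ∀ m ∈ Set.Icc (a - L) (a + L), ENNReal.ofReal (1 / 2) ≤ ENNReal.ofReal (f m) := by
    intro m hm
    have hm0 : 0 ≤ m := by linarith [hm.1, hw.left]
    have hmR : m ≤ R := by linarith [hm.2, hw.right]
    have h1 := one_le_density_add_fisherInfo measurable_density hf hac hμf
      (fun y hy => hw.isoperimetry_right hm0 hy) (fun y hy => hw.isoperimetry_left hmR hy)
    have hZ := integral_exp_neg_basePotential_bounds hR
    have h2 := h1.trans (add_le_add le_rfl (mul_le_mul_right hI' _))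
    rw [← ENNReal.ofReal_mul (by linarith), ← ENNReal.ofReal_add (hf m)
      (mul_nonneg (by linarith) (by linarith)), ENNReal.one_le_ofReal] at h2
    refine ENNReal.ofReal_le_ofReal ?_
    -- The error is at most `4 * (13 / 5) * R * (2 * ε) ≤ 20.8 / 44 < 1 / 2`.
    nlinarith [mul_le_mul_of_nonneg_right hZ.2 hε.le]
  rw [hμf, withDensity_apply _ measurableSet_Icc]
  calc ENNReal.ofReal (1 / 22) = ENNReal.ofReal (1 / 2) * ENNReal.ofReal (1 / 11) := by
        rw [← ENNReal.ofReal_mul (by norm_num)]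
        norm_num
    _ ≤ ENNReal.ofReal (1 / 2) * gibbs (wellPotential R L a) (Set.Icc (a - L) (a + L)) := by
        gcongr
        exact hw.core_mass
    _ = ∫⁻ _ in Set.Icc (a - L) (a + L), ENNReal.ofReal (1 / 2)
          ∂(gibbs (wellPotential R L a)) := by rw [setLIntegral_const]
    _ ≤ _ := setLIntegral_mono' measurableSet_Icc hhalf

end IsWell

/-! ### Indistinguishability of the targets for an algorithm -/

namespace SamplingAlgorithm

variable {n : ℕ}

theorem measurable_history (A : SamplingAlgorithm n) {V : ℝ → ℝ} (hV : Measurable V) (k : ℕ) :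
    Measurable fun p : A.Seed × (ℕ → ℝ) => A.history V p.1 p.2 k := by
  induction k with
  | zero => exact measurable_pi_lambda _ fun i => i.elim0
  | succ k ih =>
    have hq : Measurable fun p : A.Seed × (ℕ → ℝ) =>
        A.query k (p.1, p.2, A.history V p.1 p.2 k) :=
      (A.measurable_query k).comp (measurable_fst.prodMk (measurable_snd.prodMk ih))
    refine measurable_pi_lambda _ fun i => ?_
    refine Fin.lastCases ?_ (fun j => ?_) i
    · simp only [history, Fin.snoc_last]
      exact hq.prodMk ((hV.comp hq).prodMk ((measurable_deriv V).comp hq))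
    · simp only [history, Fin.snoc_castSucc]
      exact (measurable_pi_apply j).comp ih

theorem measurable_output_history (A : SamplingAlgorithm n) {V : ℝ → ℝ} (hV : Measurable V) :
    Measurable fun p : A.Seed × (ℕ → ℝ) => A.output (p.1, p.2, A.history V p.1 p.2 n) :=
  A.measurable_output.comp
    (measurable_fst.prodMk (measurable_snd.prodMk (A.measurable_history hV n)))

theorem measurable_query_history (A : SamplingAlgorithm n) {V : ℝ → ℝ} (hV : Measurable V)
    (k : ℕ) :
    Measurable fun p : A.Seed × (ℕ → ℝ) => A.query k (p.1, p.2, A.history V p.1 p.2 k) :=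
  (A.measurable_query k).comp
    (measurable_fst.prodMk (measurable_snd.prodMk (A.measurable_history hV k)))

theorem isProbabilityMeasure_outputLaw (A : SamplingAlgorithm n) {V : ℝ → ℝ} (hV : Measurable V)
    (μ₀ : Measure ℝ) [IsProbabilityMeasure μ₀] : IsProbabilityMeasure (A.outputLaw V μ₀) :=
  Measure.isProbabilityMeasure_map (A.measurable_output_history hV).aemeasurable

/-- Two potentials that agree off `W` produce the same history as long as no query hits `W`. -/
theorem history_congr (A : SamplingAlgorithm n) {V V' : ℝ → ℝ} {W : Set ℝ}
    (h : ∀ x ∉ W, V' x = V x) (h' : ∀ x ∉ W, deriv V' x = deriv V x)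
    (ζ : A.Seed) (s : ℕ → ℝ) (k : ℕ)
    (hk : ∀ j < k, A.query j (ζ, s, A.history V ζ s j) ∉ W) :
    A.history V' ζ s k = A.history V ζ s k := by
  induction k with
  | zero => rfl
  | succ k ih =>
    have hx := hk k (Nat.lt_succ_self k)
    simp only [history]
    rw [ih fun j hj => hk j (hj.trans (Nat.lt_succ_self k)), h _ hx, h' _ hx]

/-- Among `M` potentials that perturb `V` on disjoint sets `W i`, an algorithm with `n` queries
finds at most `n + 1` of the sets on average. -/
theorem sum_outputLaw_le (A : SamplingAlgorithm n) {V : ℝ → ℝ} (hV : Measurable V) {M : ℕ}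
    {V' : Fin M → ℝ → ℝ} (hV' : ∀ i, Measurable (V' i)) {W : Fin M → Set ℝ}
    (hW : ∀ i, MeasurableSet (W i)) (hd : Pairwise (Function.onFun Disjoint W))
    (h : ∀ i, ∀ x ∉ W i, V' i x = V x) (h' : ∀ i, ∀ x ∉ W i, deriv (V' i) x = deriv V x)
    (μ₀ : Measure ℝ) [IsProbabilityMeasure μ₀] :
    ∑ i, A.outputLaw (V' i) μ₀ (W i) ≤ n + 1 := by
  set P := A.seedLaw.prod (Measure.infinitePi (fun _ : ℕ => μ₀)) with hP
  set q : ℕ → A.Seed × (ℕ → ℝ) → ℝ := fun k p => A.query k (p.1, p.2, A.history V p.1 p.2 k)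
    with hq
  set o : A.Seed × (ℕ → ℝ) → ℝ := fun p => A.output (p.1, p.2, A.history V p.1 p.2 n) with ho
  have hone : ∀ g : A.Seed × (ℕ → ℝ) → ℝ, Measurable g → ∑ i, P (g ⁻¹' W i) ≤ 1 := by
    intro g hg
    have := sum_measure_le_measure_univ (μ := P) (s := Finset.univ) (t := fun i => g ⁻¹' W i)
      (fun i _ => (hg (hW i)).nullMeasurableSet)
      (fun i _ j _ hij => ((hd hij).preimage g).aedisjoint)
    rwa [measure_univ] at this
  have hi : ∀ i, A.outputLaw (V' i) μ₀ (W i) ≤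
      P (o ⁻¹' W i) + ∑ k ∈ Finset.range n, P (q k ⁻¹' W i) := by
    intro i
    rw [outputLaw, Measure.map_apply (A.measurable_output_history (hV' i)) (hW i)]
    -- Coupling by the same seed and samples: if the run on `V` never queries `W i`, the run on `V'
    -- i` has the same history and the same output.
    refine (measure_mono (t := o ⁻¹' W i ∪ ⋃ k ∈ Finset.range n, q k ⁻¹' W i) ?_).trans
      ((measure_union_le _ _).trans (by gcongr; exact measure_biUnion_finset_le _ _))
    intro p hp
    by_contra hcon
    simp only [Set.mem_union, Set.mem_iUnion, Set.mem_preimage, Finset.mem_range, not_or,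
      not_exists] at hcon
    apply hcon.1
    have := A.history_congr (h i) (h' i) p.1 p.2 n hcon.2
    rw [Set.mem_preimage, this] at hp
    exact hp
  calc ∑ i, A.outputLaw (V' i) μ₀ (W i)
      ≤ ∑ i, (P (o ⁻¹' W i) + ∑ k ∈ Finset.range n, P (q k ⁻¹' W i)) :=
        Finset.sum_le_sum fun i _ => hi i
    _ = ∑ i, P (o ⁻¹' W i) + ∑ k ∈ Finset.range n, ∑ i, P (q k ⁻¹' W i) := by
        rw [Finset.sum_add_distrib, Finset.sum_comm]
    _ ≤ 1 + ∑ k ∈ Finset.range n, 1 := by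
        gcongr with k
        · exact hone o (A.measurable_output_history hV)
        · exact hone (q k) (A.measurable_query_history hV k)
    _ = n + 1 := by simp [add_comm]

end SamplingAlgorithm

/-! ### Counting wells and choosing the parameters -/

/-- Each of the `M` targets forces output mass `1 / 22` on its own well, while these masses sum to
at most `n + 1`. -/
theorem SamplingAlgorithm.Succeeds.card_wells_le {n : ℕ} {A : SamplingAlgorithm n} {ε : ℝ}
    (hA : A.Succeeds 1 ε 1) (hε : 0 < ε) {R L : ℝ} (hRε : R * ε ≤ 1 / 44) (hR : 2 ≤ R) {B : ℝ}
    (hB : ∀ x y : ℝ, |deriv bump x - deriv bump y| ≤ B * |x - y|)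
    (hL : B * Real.log (R / (2 * L)) ≤ L ^ 2 / 2) {M : ℕ} {a : Fin M → ℝ}
    (ha : ∀ i, IsWell R L (a i))
    (hd : Pairwise (Function.onFun Disjoint
      fun i => Set.Icc (a i - 2 * L) (a i + 2 * L))) :
    (M : ℝ) ≤ 22 * (n + 1) := by
  have : IsProbabilityMeasure (gibbs (basePotential R)) :=
    isProbabilityMeasure_tilted (integrable_exp_neg_basePotential (by linarith))
  have hm : ∀ i, Measurable (wellPotential R L (a i)) := fun i =>
    (contDiff_wellPotential R L (a i)).continuous.measurable
  have hsum := A.sum_outputLaw_le (contDiff_basePotential R).continuous.measurable hm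
    (fun i => measurableSet_Icc) hd (fun i x hx => (ha i).wellPotential_eq hx)
    (fun i x hx => (ha i).deriv_wellPotential_eq hx) (gibbs (basePotential R))
  have hmass : ∀ i, ENNReal.ofReal (1 / 22) ≤
      A.outputLaw (wellPotential R L (a i)) (gibbs (basePotential R))
        (Set.Icc (a i - 2 * L) (a i + 2 * L)) := by
    intro i
    have := A.isProbabilityMeasure_outputLaw (hm i) (gibbs (basePotential R))
    refine ((ha i).le_measure_core hε hRε (hA _ ((ha i).isLogSmoothPotential hR hB hL)
      (gibbs (basePotential R)) (ha i).klDiv_le)).trans (measure_mono ?_)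
    have := (ha i).pos
    exact Set.Icc_subset_Icc (by linarith) (by linarith)
  have h1 : (M : ℝ≥0∞) * ENNReal.ofReal (1 / 22) ≤ n + 1 := by
    refine le_trans ?_ ((Finset.sum_le_sum fun i _ => hmass i).trans hsum)
    simp
  have h2 : ENNReal.ofReal (M * (1 / 22)) ≤ ENNReal.ofReal (n + 1) := by
    rw [ENNReal.ofReal_mul (by positivity), ENNReal.ofReal_add (by positivity) zero_le_one]
    simpa using h1
  rw [ENNReal.ofReal_le_ofReal_iff (by positivity)] at h2
  linarith

theorem SamplingAlgorithm.Succeeds.le_queries {n : ℕ} {A : SamplingAlgorithm n} {ε : ℝ}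
    (hA : A.Succeeds 1 ε 1) (hε : 0 < ε) {B : ℝ} (hB1 : 1 ≤ B)
    (hB : ∀ x y : ℝ, |deriv bump x - deriv bump y| ≤ B * |x - y|)
    (hεB : 105800 * B ≤ 1 / (44 * ε)) :
    1 / (9680 * Real.sqrt (2 * B)) * (1 / (ε * Real.sqrt (Real.log (1 / ε)))) ≤ n := by
  set R := 1 / (44 * ε) with hRdef
  -- Chosen so that `B * log R = L ^ 2 / 2`; since `L ≥ 1`, the depth is at most `log R` and
  -- smoothness follows.
  set L := Real.sqrt (2 * B * Real.log R) with hLdef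
  have hR : 105800 ≤ R := by linarith
  have hlog1 : 1 ≤ Real.log R := by
    rw [Real.le_log_iff_exp_le (by linarith)]
    linarith [Real.exp_one_lt_d9]
  have hL1 : 1 ≤ L := Real.le_sqrt_of_sq_le (by nlinarith)
  have hLsq : L ^ 2 = 2 * B * Real.log R := Real.sq_sqrt (by positivity)
  -- The threshold on `R` is `105800 * B = 2 * 230 ^ 2 * B`, and `log R ≤ R`.
  have hLR : 230 * L ≤ R := by
    refine le_of_sq_le_sq ?_ (by linarith)
    nlinarith [Real.log_le_self (show 0 ≤ R by linarith)]
  have hRε : R * ε = 1 / 44 := by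
    rw [hRdef]
    field_simp
  set M := ⌊R / (5 * L)⌋₊ with hM
  have hMle : (M : ℝ) * (5 * L) ≤ R := by
    rw [← le_div_iff₀ (by positivity)]
    exact Nat.floor_le (by positivity)
  -- Wells of width `4 * L` at spacing `5 * L` are disjoint even as closed intervals; the first
  -- starts at `0`.
  have hcard := hA.card_wells_le hε hRε.le (by linarith) hB (L := L) (M := M)
    (a := fun i => 5 * L * i + 2 * L) ?_ ?_ ?_
  · have h1 : R / (5 * L) ≤ 22 * n + 23 := by
      have := Nat.lt_floor_add_one (R / (5 * L))
      rw [← hM] at this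
      linarith
    -- With at least `46` available places, the additive `23` costs only a factor `2`, whence `220 =
    -- 5 * 44`.
    have h2 : 46 ≤ R / (5 * L) := by
      rw [le_div_iff₀ (by positivity)]
      linarith
    have h3 : R / (220 * L) ≤ n := by
      have : R / (220 * L) = R / (5 * L) / 44 := by
        field_simp
        norm_num
      rw [this]
      linarith
    refine le_trans ?_ h3
    have hε1 : R ≤ 1 / ε := by
      rw [hRdef]
      gcongr
      linarith
    have hsqrt : L ≤ Real.sqrt (2 * B) * Real.sqrt (Real.log (1 / ε)) := by
      rw [← Real.sqrt_mul (by positivity), hLdef]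
      gcongr
    calc _ = R / (220 * (Real.sqrt (2 * B) * Real.sqrt (Real.log (1 / ε)))) := by
          rw [hRdef]
          field_simp
          norm_num
      _ ≤ _ := by gcongr
  · rw [hLsq]
    have : Real.log (R / (2 * L)) ≤ Real.log R := by
      refine Real.log_le_log (by positivity) (div_le_self (by positivity) (by linarith))
    nlinarith
  · intro i
    have hi : ((i : ℕ) : ℝ) + 1 ≤ M := by exact_mod_cast i.2
    refine ⟨by linarith, by linarith, le_add_of_nonneg_left (by positivity), ?_⟩
    nlinarith
  · intro i j hij
    have hne : (i : ℕ) ≠ (j : ℕ) := fun h => hij (Fin.ext h)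
    refine Set.disjoint_left.2 fun x hx hx' => ?_
    rcases lt_or_gt_of_ne hne with h | h
    · have h' : ((i : ℕ) : ℝ) + 1 ≤ (j : ℕ) := by exact_mod_cast h
      nlinarith [hx.2, hx'.1]
    · have h' : ((j : ℕ) : ℝ) + 1 ≤ (i : ℕ) := by exact_mod_cast h
      nlinarith [hx.1, hx'.2]

end FisherSampling

end

theorem theorem4p2 :
    ∃ c : ℝ, 0 < c ∧ c < 1 ∧ ∃ C : ℝ, 0 < C ∧ ∀ ε : ℝ, 0 < ε → ε < c →
      ENNReal.ofReal (C * (1 / (ε * Real.sqrt (Real.log (1 / ε))))) ≤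
        ((FisherSampling.queryComplexity 1 ε 1 : ℕ∞) : ENNReal) := by
  obtain ⟨B, hB1, hB⟩ := FisherSampling.exists_lipschitz_deriv_bump
  refine ⟨1 / (44 * (105800 * B)), by positivity, ?_, 1 / (9680 * Real.sqrt (2 * B)),
    by positivity, fun ε hε hεc => ?_⟩
  · rw [div_lt_one (by positivity)]
    linarith
  · set x := 1 / (9680 * Real.sqrt (2 * B)) * (1 / (ε * Real.sqrt (Real.log (1 / ε))))
    have hεB : 105800 * B ≤ 1 / (44 * ε) := by
      rw [lt_div_iff₀ (by positivity)] at hεc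
      rw [le_div_iff₀ (by positivity)]
      linarith
    -- Rounding up first lets the infimum be bounded within `ℕ∞`; if no algorithm succeeds it is
    -- `⊤`.
    have hle : ((⌈x⌉₊ : ℕ) : ℕ∞) ≤ FisherSampling.queryComplexity 1 ε 1 := by
      refine le_iInf₂ fun n ⟨A, hA⟩ => ?_
      exact_mod_cast Nat.ceil_le.2 (hA.le_queries hε hB1 hB hεB)
    calc ENNReal.ofReal x ≤ ENNReal.ofReal (⌈x⌉₊ : ℕ) := ENNReal.ofReal_le_ofReal (Nat.le_ceil x)
      _ = (((⌈x⌉₊ : ℕ) : ℕ∞) : ENNReal) := by simp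
      _ ≤ _ := ENat.toENNReal_le.2 hle
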